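/- For integers $k,\ell,j\ge 0$ let $$\mathcal A(k,\ell,j)=\sum_{\substack{\alpha_0,\dots,\alpha_j\ge 0\\ \alpha_0+\dots+\alpha_j=k}}\ \sum_{\substack{\beta_0,\dots,\beta_j\ge 0\\ \beta_0+\dots+\beta_j=\ell}}\ \prod_{r=0}^{j}\binom{\alpha_r+\beta_r}{\alpha_r}^2 ,$$ where the $\alpha_r,\beta_r$ are integers, and let $F(x,y,z)=\sum_{k,\ell,j\ge 0}\mathcal A(k,\ell,j)\,x^k y^\ell z^j$ be its generating function. For $\kappa,\lambda,\gamma\in(0,\infty)$ put $$X=\frac{\kappa(2\kappa+\gamma)}{(\kappa+\lambda+\gamma)(2\kappa+2\lambda+\gamma)},\qquad Y=\frac{\lambda(2\lambda+\gamma)}{(\kappa+\lambda+\gamma)(2\kappa+2\lambda+\gamma)},$$ $$Z=\frac{1}{\kappa+\lambda+\gamma}\left(\frac{\gamma(2\kappa+\gamma)(2\lambda+\gamma)}{2\kappa+2\lambda+\gamma}\right)^{1/2}.$$ (a) If $(k_N)$, $(\ell_N)$, $(j_N)$ are sequences of non-negative integers with $k_N/N\to\kappa$, $\ell_N/N\to\lambda$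 and $j_N/N\to\gamma$ as $N\to\infty$, then $$\lim_{N\to\infty}N^{-1}\ln \mathcal A(k_N,\ell_N,j_N)=-\kappa\ln X-\lambda\ln Y-\gamma\ln Z .$$ (b) The point $(X,Y,Z)$ lies on the affine variety $z^2=1-2(x+y)+(x-y)^2$, and it is a singular point of $F$: the power series $F$ converges absolutely on the open polydisc $\{(x,y,z)\in\mathbb C^3: |x|<X,\ |y|<Y,\ |z|<Z\}$, and its sum there has no analytic continuation to a neighbourhood of $(X,Y,Z)$. -/

import Mathlib

open Filter Topology

namespace Pinsky

/-- Pinsky's combinatorial array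
`𝒜(k, ℓ, j) = ∑_{α₀+⋯+α_j = k} ∑_{β₀+⋯+β_j = ℓ} ∏_{r=0}^{j} binom(α_r + β_r, α_r)²`,
the sums being over `(j+1)`-tuples of natural numbers. -/
def array (k l j : ℕ) : ℕ :=
  ∑ α ∈ Finset.Nat.antidiagonalTuple (j + 1) k,
    ∑ β ∈ Finset.Nat.antidiagonalTuple (j + 1) l,
      ∏ r : Fin (j + 1), ((α r + β r).choose (α r)) ^ 2

/-- The term `𝒜(k, ℓ, j) x^k y^ℓ z^j` of the generating function, at `p = (x, y, z)`,
with index `n = (k, ℓ, j)`. -/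
def genTerm (p : ℂ × ℂ × ℂ) (n : ℕ × ℕ × ℕ) : ℂ :=
  (array n.1 n.2.1 n.2.2 : ℂ) * p.1 ^ n.1 * p.2.1 ^ n.2.1 * p.2.2 ^ n.2.2

/-- The generating function `F(x, y, z) = ∑_{k, ℓ, j ≥ 0} 𝒜(k, ℓ, j) x^k y^ℓ z^j`
(meaningful where the series converges absolutely). -/
noncomputable def genFun (p : ℂ × ℂ × ℂ) : ℂ :=
  ∑' n : ℕ × ℕ × ℕ, genTerm p n

/-- The open polydisc about the origin with polyradius `(‖x‖, ‖y‖, ‖z‖)`, for `p = (x, y, z)`. -/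
def polydisc (p : ℂ × ℂ × ℂ) : Set (ℂ × ℂ × ℂ) :=
  {q | ‖q.1‖ < ‖p.1‖ ∧ ‖q.2.1‖ < ‖p.2.1‖ ∧ ‖q.2.2‖ < ‖p.2.2‖}

/-- `p` is a (minimal) singular point of the generating function: the series converges absolutely
on the open polydisc that has `p` on its distinguished boundary, and its sum there does not extend
analytically to a neighbourhood of `p`. (If a coordinate of `p` vanishes, the polydisc is empty,
the second clause fails, and `p` is not singular in this sense.) -/
def IsSingularPoint (p : ℂ × ℂ × ℂ) : Prop :=
  (∀ q ∈ polydisc p, Summable fun n : ℕ × ℕ × ℕ => ‖genTerm q n‖) ∧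
    ¬ ∃ G : ℂ × ℂ × ℂ → ℂ, AnalyticAt ℂ G p ∧ ∀ᶠ q in 𝓝[polydisc p] p, G q = genFun q

/-- The affine variety `z² = 1 - 2(x + y) + (x - y)²`, where the denominator of
`F(x, y, z) = 1 / ((1 - 2(x + y) + (x - y)²)^{1/2} - z)`, once rationalized, vanishes. -/
def singularVariety : Set (ℂ × ℂ × ℂ) :=
  {p | p.2.2 ^ 2 = 1 - 2 * (p.1 + p.2.1) + (p.1 - p.2.1) ^ 2}

noncomputable def X (kap lam gam : ℝ) : ℝ :=
  kap * (2 * kap + gam) / ((kap + lam + gam) * (2 * kap + 2 * lam + gam))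

noncomputable def Y (kap lam gam : ℝ) : ℝ :=
  lam * (2 * lam + gam) / ((kap + lam + gam) * (2 * kap + 2 * lam + gam))

noncomputable def Z (kap lam gam : ℝ) : ℝ :=
  1 / (kap + lam + gam) *
    Real.sqrt (gam * (2 * kap + gam) * (2 * lam + gam) / (2 * kap + 2 * lam + gam))

end Pinsky

/-! The tuple sums are convolutions, so the `(k, ℓ)`-generating function of `𝒜(·, ·, j)` is the
`(j+1)`-st power of that of `binom(k+ℓ, k)²`, which is `q^{-1/2}` for `q = 1 - 2(x+y) + (x-y)²`.
Thus the section at fixed `j` is `q^{-(j+1)/2}`, and its coefficients have a closed form in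
factorials and double factorials (`array_eq`). This is proved formally: along each ray `(tx, ty)`
both candidates become power series in `t`, and the closed form satisfies the first-order equation
that characterizes `q^{-(j+1)/2}`.

Part (a) is then Stirling's formula applied factor by factor.

For (b), `Z² = q(X, Y)` and `√X + √Y < 1`, so the section at `(X, Y)` converges to `Z^{-(j+1)}`
(`hasSum_array_mul`). This bounds each term, which gives convergence on the polydisc by comparison
with geometric series. Multiplied by `Z^j`, every section contributes the same constant `Z⁻¹`, so
`F` diverges at `(X, Y, Z)`. Since the coefficients are nonnegative, Pringsheim's argument excludes
an analytic continuation. -/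

namespace Pinsky

open Finset Nat

/-! ### Recurrences for the closed form -/

/-- The closed form of `array k l j`. -/
noncomputable def closedForm (j k l : ℕ) : ℝ :=
  ((j + k + l)! * (j + 2 * k + 2 * l)‼ * j‼ : ℝ) /
    (j ! * k ! * l ! * (j + 2 * k)‼ * (j + 2 * l)‼)

theorem closedForm_symm (j k l : ℕ) : closedForm j k l = closedForm j l k := by
  unfold closedForm
  rw [show j + k + l = j + l + k by ring, show j + 2 * k + 2 * l = j + 2 * l + 2 * k by ring]
  congr 1
  ring

/-- The closed form is hypergeometric. The recurrences below rest only on this ratio and on the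
symmetry in `k` and `l`. -/
theorem closedForm_succ (j k l : ℕ) :
    ((k : ℝ) + 1) * (j + 2 * k + 2) * closedForm j (k + 1) l =
      (j + k + l + 1) * (j + 2 * k + 2 * l + 2) * closedForm j k l := by
  unfold closedForm
  have hd (n : ℕ) : ((n ‼ : ℕ) : ℝ) ≠ 0 := by exact_mod_cast (doubleFactorial_pos n).ne'
  have hf (n : ℕ) : ((n ! : ℕ) : ℝ) ≠ 0 := by exact_mod_cast factorial_ne_zero n
  rw [show j + (k + 1) + l = (j + k + l) + 1 by ring,
    show j + 2 * (k + 1) + 2 * l = (j + 2 * k + 2 * l) + 2 by ring,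
    show j + 2 * (k + 1) = (j + 2 * k) + 2 by ring, doubleFactorial_add_two,
    doubleFactorial_add_two, factorial_succ, factorial_succ]
  have h1 : ((k : ℝ) + 1) ≠ 0 := by positivity
  have h2 : ((j : ℝ) + 2 * k + 2) ≠ 0 := by positivity
  have := hd (j + 2 * k)
  have := hd (j + 2 * l)
  have := hf j
  have := hf k
  have := hf l
  push_cast
  field_simp

/-- Shift of a double sequence in the first index. -/
def shiftLeft (a : ℕ → ℕ → ℝ) : ℕ → ℕ → ℝ
  | 0, _ => 0
  | k + 1, l => a k l

/-- Shift of a double sequence in the second index. -/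
def shiftRight (a : ℕ → ℕ → ℝ) : ℕ → ℕ → ℝ
  | _, 0 => 0
  | k, l + 1 => a k l

/-- The homogeneous part of degree `n` of the double power series with coefficients `a`. -/
def homogPart (a : ℕ → ℕ → ℝ) (x y : ℝ) (n : ℕ) : ℝ :=
  ∑ p ∈ antidiagonal n, a p.1 p.2 * x ^ p.1 * y ^ p.2

theorem homogPart_shiftLeft (a : ℕ → ℕ → ℝ) (x y : ℝ) (n : ℕ) :
    homogPart (shiftLeft a) x y (n + 1) = x * homogPart a x y n := by
  unfold homogPart
  rw [Finset.Nat.sum_antidiagonal_succ, mul_sum]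
  simp only [shiftLeft, zero_mul, zero_add]
  exact sum_congr rfl fun p _ => by ring

theorem homogPart_shiftRight (a : ℕ → ℕ → ℝ) (x y : ℝ) (n : ℕ) :
    homogPart (shiftRight a) x y (n + 1) = y * homogPart a x y n := by
  unfold homogPart
  rw [Finset.Nat.sum_antidiagonal_succ', mul_sum]
  simp only [shiftRight, zero_mul, zero_add]
  exact sum_congr rfl fun p _ => by ring

theorem shiftLeft_closedForm (j k l : ℕ) :
    (j + k + l : ℝ) * (j + 2 * k + 2 * l) * shiftLeft (closedForm j) k l =
      k * (j + 2 * k) * closedForm j k l := by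
  cases k with
  | zero => simp [shiftLeft]
  | succ k =>
    have := closedForm_succ j k l
    simp only [shiftLeft]
    push_cast
    linear_combination -this

theorem shiftRight_closedForm (j k l : ℕ) :
    (j + k + l : ℝ) * (j + 2 * k + 2 * l) * shiftRight (closedForm j) k l =
      l * (j + 2 * l) * closedForm j k l := by
  cases l with
  | zero => simp [shiftRight]
  | succ l =>
    have := closedForm_succ j l k
    rw [closedForm_symm, closedForm_symm j l] at this
    simp only [shiftRight]
    push_cast
    linear_combination -this

theorem shiftLeft_shiftLeft_closedForm (j k l : ℕ) :
    (j + k + l - 1 : ℝ) * (j + 2 * k + 2 * l - 2) * shiftLeft (shiftLeft (closedForm j)) k l =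
      (k - 1) * (j + 2 * k - 2) * shiftLeft (closedForm j) k l := by
  cases k with
  | zero => simp [shiftLeft]
  | succ k =>
    have := shiftLeft_closedForm j k l
    simp only [shiftLeft] at this ⊢
    push_cast
    linear_combination this

theorem shiftLeft_shiftRight_closedForm (j k l : ℕ) :
    (j + k + l - 1 : ℝ) * (j + 2 * k + 2 * l - 2) * shiftLeft (shiftRight (closedForm j)) k l =
      l * (j + 2 * l) * shiftLeft (closedForm j) k l := by
  cases k with
  | zero => simp [shiftLeft]
  | succ k =>
    have := shiftRight_closedForm j k l
    simp only [shiftLeft] at this ⊢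
    push_cast
    linear_combination this

theorem shiftRight_shiftRight_closedForm (j k l : ℕ) :
    (j + k + l - 1 : ℝ) * (j + 2 * k + 2 * l - 2) * shiftRight (shiftRight (closedForm j)) k l =
      (l - 1) * (j + 2 * l - 2) * shiftRight (closedForm j) k l := by
  cases l with
  | zero => simp [shiftRight]
  | succ l =>
    have := shiftRight_closedForm j k l
    simp only [shiftRight] at this ⊢
    push_cast
    linear_combination this

/-- This is the coefficient form of the differential equation for `q^{-(j+1)/2}` in the radial
variable. Having `k + l ≥ 2` keeps the denominators of the hypergeometric ratios nonzero. -/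
theorem closedForm_recurrence (j k l : ℕ) (h : 2 ≤ k + l) :
    (k + l : ℝ) * closedForm j k l =
      (2 * (k + l) + j - 1) * (shiftLeft (closedForm j) k l + shiftRight (closedForm j) k l) -
      (k + l + j - 1) * (shiftLeft (shiftLeft (closedForm j)) k l
        - 2 * shiftLeft (shiftRight (closedForm j)) k l
        + shiftRight (shiftRight (closedForm j)) k l) := by
  have hN : (2 : ℝ) ≤ k + l := by exact_mod_cast h
  have hj : (0 : ℝ) ≤ j := j.cast_nonneg
  have e1 := shiftLeft_closedForm j k l
  have e2 := shiftRight_closedForm j k l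
  have e3 := shiftLeft_shiftLeft_closedForm j k l
  have e4 := shiftLeft_shiftRight_closedForm j k l
  have e5 := shiftRight_shiftRight_closedForm j k l
  have h1 : (j + k + l : ℝ) ≠ 0 := by linarith
  have h2 : (j + 2 * k + 2 * l : ℝ) ≠ 0 := by linarith
  have h3 : (j + k + l - 1 : ℝ) ≠ 0 := by linarith
  have h4 : (j + 2 * k + 2 * l - 2 : ℝ) ≠ 0 := by linarith
  -- After clearing denominators, `e3`, `e4`, `e5` reduce double shifts to single ones, and `e1`,
  -- `e2` reduce these to `closedForm j k l`; a polynomial identity remains.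
  apply mul_left_cancel₀ (mul_ne_zero (mul_ne_zero h1 h2) (mul_ne_zero h3 h4))
  linear_combination -(2 * (k + l) + j - 1) * ((j + k + l - 1) * (j + 2 * k + 2 * l - 2)) * (e1 + e2)
    + (k + l + j - 1) * ((j + k + l) * (j + 2 * k + 2 * l)) * (e3 - 2 * e4 + e5)
    + (k + l + j - 1) * (((k - 1) * (j + 2 * k - 2) - 2 * (l * (j + 2 * l))) * e1 +
      (l - 1) * (j + 2 * l - 2) * e2)

theorem homogPart_closedForm_zero (j : ℕ) (x y : ℝ) : homogPart (closedForm j) x y 0 = 1 := by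
  have hd : ((j ‼ : ℕ) : ℝ) ≠ 0 := by exact_mod_cast (doubleFactorial_pos j).ne'
  have hf : ((j ! : ℕ) : ℝ) ≠ 0 := by exact_mod_cast factorial_ne_zero j
  simp only [homogPart, antidiagonal_zero, sum_singleton, closedForm, mul_zero, add_zero, pow_zero,
    mul_one, factorial_zero, Nat.cast_one]
  field_simp

theorem closedForm_zero_zero (j : ℕ) : closedForm j 0 0 = 1 := by
  simpa [homogPart] using homogPart_closedForm_zero j 0 0

theorem closedForm_one_zero (j : ℕ) : closedForm j 1 0 = j + 1 := by
  have h := closedForm_succ j 0 0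
  rw [closedForm_zero_zero] at h
  have h2 : ((j : ℝ) + 2) ≠ 0 := by positivity
  apply mul_left_cancel₀ h2
  push_cast at h
  linear_combination h

theorem homogPart_closedForm_one (j : ℕ) (x y : ℝ) :
    homogPart (closedForm j) x y 1 = (j + 1) * (x + y) := by
  have h : closedForm j 0 1 = j + 1 := by rw [closedForm_symm, closedForm_one_zero]
  simp [homogPart, Finset.Nat.antidiagonal_succ, h, closedForm_one_zero]
  ring

theorem homogPart_closedForm_add_two (j : ℕ) (x y : ℝ) (n : ℕ) :
    (n + 2 : ℝ) * homogPart (closedForm j) x y (n + 2) =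
      (2 * n + j + 3) * ((x + y) * homogPart (closedForm j) x y (n + 1)) -
      (n + j + 1) * ((x - y) ^ 2 * homogPart (closedForm j) x y n) := by
  have e1 := homogPart_shiftLeft (closedForm j) x y (n + 1)
  have e2 := homogPart_shiftRight (closedForm j) x y (n + 1)
  have e3 : homogPart (shiftLeft (shiftLeft (closedForm j))) x y (n + 2) = _ :=
    (homogPart_shiftLeft _ x y (n + 1)).trans (congrArg _ (homogPart_shiftLeft _ x y n))
  have e4 : homogPart (shiftLeft (shiftRight (closedForm j))) x y (n + 2) = _ :=
    (homogPart_shiftLeft _ x y (n + 1)).trans (congrArg _ (homogPart_shiftRight _ x y n))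
  have e5 : homogPart (shiftRight (shiftRight (closedForm j))) x y (n + 2) = _ :=
    (homogPart_shiftRight _ x y (n + 1)).trans (congrArg _ (homogPart_shiftRight _ x y n))
  have key : (n + 2 : ℝ) * homogPart (closedForm j) x y (n + 2) =
      (2 * n + j + 3) * (homogPart (shiftLeft (closedForm j)) x y (n + 2) +
        homogPart (shiftRight (closedForm j)) x y (n + 2)) -
      (n + j + 1) * (homogPart (shiftLeft (shiftLeft (closedForm j))) x y (n + 2) -
        2 * homogPart (shiftLeft (shiftRight (closedForm j))) x y (n + 2) +
        homogPart (shiftRight (shiftRight (closedForm j))) x y (n + 2)) := by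
    simp only [homogPart, mul_sum, ← sum_add_distrib, ← sum_sub_distrib]
    refine sum_congr rfl fun p hp => ?_
    have hp' : p.1 + p.2 = n + 2 := mem_antidiagonal.1 hp
    have hn : (p.1 : ℝ) + p.2 = n + 2 := by exact_mod_cast hp'
    have := closedForm_recurrence j p.1 p.2 (by omega)
    rw [hn] at this
    linear_combination (x ^ p.1 * y ^ p.2) * this
  rw [key, e1, e2, e3, e4, e5]
  ring

/-! ### The radial series and its differential equation -/

open PowerSeries in
/-- The polynomial `1 - 2 (x + y) t + (x - y)² t²` as a power series in `t`. -/
noncomputable def quad (x y : ℝ) : ℝ⟦X⟧ :=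
  1 - C (2 * (x + y)) * PowerSeries.X + C ((x - y) ^ 2) * PowerSeries.X ^ 2

open PowerSeries in
theorem constantCoeff_quad (x y : ℝ) : constantCoeff (quad x y) = 1 := by simp [quad]

open PowerSeries in
theorem derivative_quad (x y : ℝ) :
    d⁄dX ℝ (quad x y) = -C (2 * (x + y)) + C (2 * (x - y) ^ 2) * PowerSeries.X := by
  simp only [quad, map_add, map_sub, Derivation.leibniz, derivative_one, derivative_C, derivative_X,
    derivative_pow, smul_eq_mul]
  simp only [map_mul, map_ofNat]
  push_cast
  ring

open PowerSeries in
/-- The double series with coefficients `a`, at `(t x, t y)`, as a power series in `t`. -/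
noncomputable def radialSeries (a : ℕ → ℕ → ℝ) (x y : ℝ) : ℝ⟦X⟧ := mk (homogPart a x y)

-- Coefficientwise this is the three-term recurrence for the homogeneous parts; the two lowest
-- coefficients use the explicit parts of degree 0 and 1.
open PowerSeries in
theorem radialSeries_closedForm_ode (j : ℕ) (x y : ℝ) :
    2 * quad x y * d⁄dX ℝ (radialSeries (closedForm j) x y) +
      ((j : ℝ⟦X⟧) + 1) * d⁄dX ℝ (quad x y) * radialSeries (closedForm j) x y = 0 := by
  have e : 2 * quad x y * d⁄dX ℝ (radialSeries (closedForm j) x y) +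
      ((j : ℝ⟦X⟧) + 1) * d⁄dX ℝ (quad x y) * radialSeries (closedForm j) x y =
      C 2 * d⁄dX ℝ (radialSeries (closedForm j) x y)
      + C (-4 * (x + y)) * (d⁄dX ℝ (radialSeries (closedForm j) x y) * PowerSeries.X)
      + C (2 * (x - y) ^ 2) * (d⁄dX ℝ (radialSeries (closedForm j) x y) * PowerSeries.X * PowerSeries.X)
      + C (-(j + 1) * (2 * (x + y))) * radialSeries (closedForm j) x y
      + C ((j + 1) * (2 * (x - y) ^ 2)) * (radialSeries (closedForm j) x y * PowerSeries.X) := by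
    rw [derivative_quad, quad]
    simp only [map_mul, map_neg, map_add, map_one, map_ofNat, map_natCast]
    ring
  rw [e]
  ext n
  rcases n with _ | _ | n
  · simp only [map_add, coeff_C_mul, coeff_derivative, coeff_zero_mul_X, radialSeries, coeff_mk,
      homogPart_closedForm_zero, homogPart_closedForm_one, zero_add]
    simp
    ring
  · have := homogPart_closedForm_add_two j x y 0
    simp only [map_add, coeff_C_mul, coeff_derivative, coeff_succ_mul_X, coeff_zero_mul_X,
      radialSeries, coeff_mk, homogPart_closedForm_zero, homogPart_closedForm_one, zero_add] at this ⊢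
    push_cast at this ⊢
    simp
    linear_combination 2 * this
  · have := homogPart_closedForm_add_two j x y (n + 1)
    simp only [map_add, coeff_C_mul, coeff_derivative, coeff_succ_mul_X,
      radialSeries, coeff_mk] at this ⊢
    push_cast at this ⊢
    simp
    linear_combination 2 * this

open PowerSeries in
theorem constantCoeff_radialSeries_closedForm (j : ℕ) (x y : ℝ) :
    constantCoeff (radialSeries (closedForm j) x y) = 1 := by
  rw [← coeff_zero_eq_constantCoeff_apply, radialSeries, coeff_mk, homogPart_closedForm_zero]

-- With `P` the series and `Q` the quadratic, the derivative of `P² Q^(j+1)` is `P Q^j (2QP' +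
-- (j+1)Q'P) = 0`. Squaring avoids half-integer powers of `Q`.
open PowerSeries in
theorem radialSeries_closedForm_sq_mul (j : ℕ) (x y : ℝ) :
    radialSeries (closedForm j) x y ^ 2 * quad x y ^ (j + 1) = 1 := by
  apply derivative.ext
  · have := radialSeries_closedForm_ode j x y
    simp only [Derivation.leibniz, derivative_pow, smul_eq_mul, derivative_one]
    push_cast
    linear_combination (quad x y ^ j * radialSeries (closedForm j) x y) * this
  · simp [constantCoeff_radialSeries_closedForm, constantCoeff_quad]

-- Both sides have the same square in a domain, and constant coefficient 1 fixes the sign.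
open PowerSeries in
theorem radialSeries_closedForm_eq_pow (j : ℕ) (x y : ℝ) :
    radialSeries (closedForm j) x y = radialSeries (closedForm 0) x y ^ (j + 1) := by
  have h0 := radialSeries_closedForm_sq_mul 0 x y
  have hj := radialSeries_closedForm_sq_mul j x y
  have hq : quad x y ^ (j + 1) ≠ 0 := right_ne_zero_of_mul_eq_one hj
  have hsq : radialSeries (closedForm j) x y ^ 2 =
      (radialSeries (closedForm 0) x y ^ (j + 1)) ^ 2 := by
    apply mul_right_cancel₀ hq
    rw [hj, ← pow_mul, mul_comm (j + 1) 2, pow_mul, ← mul_pow]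
    rw [zero_add, pow_one] at h0
    rw [h0, one_pow]
  rcases sq_eq_sq_iff_eq_or_eq_neg.1 hsq with h | h
  · exact h
  · have := congrArg constantCoeff h
    simp only [map_neg, map_pow, constantCoeff_radialSeries_closedForm, one_pow] at this
    norm_num at this

/-! ### The array as a convolution power -/

theorem closedForm_zero_left (k l : ℕ) : closedForm 0 k l = ((k + l).choose k : ℝ) ^ 2 := by
  have hf (n : ℕ) : ((n ! : ℕ) : ℝ) ≠ 0 := by exact_mod_cast factorial_ne_zero n
  have h1 := hf k
  have h2 := hf l
  rw [Nat.cast_add_choose]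
  simp only [closedForm, zero_add, ← mul_add, doubleFactorial_two_mul]
  push_cast
  simp only [pow_add, factorial_zero, doubleFactorial, Nat.cast_one]
  field_simp

theorem sum_antidiagonalTuple_succ {M : Type*} [AddCommMonoid M] (m n : ℕ)
    (f : (Fin (m + 1) → ℕ) → M) :
    ∑ a ∈ Finset.Nat.antidiagonalTuple (m + 1) n, f a =
      ∑ p ∈ antidiagonal n, ∑ a ∈ Finset.Nat.antidiagonalTuple m p.2, f (Fin.cons p.1 a) := by
  rw [sum_sigma']
  refine sum_bij' (fun a _ => ⟨(a 0, ∑ i, Fin.tail a i), Fin.tail a⟩)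
    (fun q _ => Fin.cons q.1.1 q.2) ?_ ?_ ?_ ?_ ?_
  · intro a ha
    rw [Finset.Nat.mem_antidiagonalTuple, Fin.sum_univ_succ] at ha
    simp only [mem_sigma, HasAntidiagonal.mem_antidiagonal, Finset.Nat.mem_antidiagonalTuple, and_true]
    exact ha
  · rintro ⟨⟨u, v⟩, a⟩ h
    simp only [mem_sigma, HasAntidiagonal.mem_antidiagonal, Finset.Nat.mem_antidiagonalTuple] at h
    simp [Finset.Nat.mem_antidiagonalTuple, Fin.sum_univ_succ, h.2, h.1]
  · intro a _
    exact Fin.cons_self_tail a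
  · rintro ⟨⟨u, v⟩, a⟩ h
    simp only [mem_sigma, HasAntidiagonal.mem_antidiagonal, Finset.Nat.mem_antidiagonalTuple] at h
    obtain ⟨-, rfl⟩ := h
    simp
  · intro a _
    simp

theorem array_zero_right (k l : ℕ) : array k l 0 = (k + l).choose k ^ 2 := by
  simp [array]

/-- Splitting off `α₀` and `β₀` leaves tuples that are one shorter. -/
theorem array_succ_right (k l j : ℕ) :
    array k l (j + 1) = ∑ p ∈ antidiagonal k, ∑ q ∈ antidiagonal l,
      array p.1 q.1 0 * array p.2 q.2 j := by
  rw [array, sum_antidiagonalTuple_succ]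
  refine sum_congr rfl fun p _ => ?_
  simp only [sum_antidiagonalTuple_succ (j + 1) l]
  rw [sum_comm]
  refine sum_congr rfl fun q _ => ?_
  rw [array_zero_right, array, mul_sum]
  refine sum_congr rfl fun a _ => ?_
  rw [mul_sum]
  refine sum_congr rfl fun b _ => ?_
  rw [Fin.prod_univ_succ]
  simp

/-- The coefficients of a product of two double power series. -/
def conv (a b : ℕ → ℕ → ℝ) (k l : ℕ) : ℝ :=
  ∑ p ∈ antidiagonal k, ∑ q ∈ antidiagonal l, a p.1 q.1 * b p.2 q.2

/-- Both sides sum over 2 × 2 arrays of naturals with total `n`, grouped by rows or by columns; the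
bijection is transposition. -/
theorem homogPart_conv (a b : ℕ → ℕ → ℝ) (x y : ℝ) (n : ℕ) :
    homogPart (conv a b) x y n =
      ∑ p ∈ antidiagonal n, homogPart a x y p.1 * homogPart b x y p.2 := by
  simp only [homogPart, sum_mul_sum]
  simp only [conv, sum_mul]
  simp only [sum_sigma']
  refine sum_bij' (fun q _ => ⟨(q.2.1.1 + q.2.2.1, q.2.1.2 + q.2.2.2),
      ⟨(q.2.1.1, q.2.2.1), (q.2.1.2, q.2.2.2)⟩⟩)
    (fun q _ => ⟨(q.2.1.1 + q.2.2.1, q.2.1.2 + q.2.2.2),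
      ⟨(q.2.1.1, q.2.2.1), (q.2.1.2, q.2.2.2)⟩⟩)
    ?_ ?_ ?_ ?_ ?_
  · rintro ⟨⟨k, l⟩, ⟨a, a'⟩, ⟨b, b'⟩⟩ h
    simp only [mem_sigma, HasAntidiagonal.mem_antidiagonal] at h ⊢
    obtain ⟨rfl, rfl, rfl⟩ := h
    exact ⟨add_add_add_comm _ _ _ _, trivial, trivial⟩
  · rintro ⟨⟨i, i'⟩, ⟨a, b⟩, ⟨a', b'⟩⟩ h
    simp only [mem_sigma, HasAntidiagonal.mem_antidiagonal] at h ⊢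
    obtain ⟨rfl, rfl, rfl⟩ := h
    exact ⟨add_add_add_comm _ _ _ _, trivial, trivial⟩
  · rintro ⟨⟨k, l⟩, ⟨a, a'⟩, ⟨b, b'⟩⟩ h
    simp only [mem_sigma, HasAntidiagonal.mem_antidiagonal] at h
    obtain ⟨-, rfl, rfl⟩ := h
    rfl
  · rintro ⟨⟨i, i'⟩, ⟨a, b⟩, ⟨a', b'⟩⟩ h
    simp only [mem_sigma, HasAntidiagonal.mem_antidiagonal] at h
    obtain ⟨-, rfl, rfl⟩ := h
    rfl
  · rintro ⟨⟨k, l⟩, ⟨a, a'⟩, ⟨b, b'⟩⟩ h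
    simp only [mem_sigma, HasAntidiagonal.mem_antidiagonal] at h
    obtain ⟨-, rfl, rfl⟩ := h
    simp only [pow_add]
    ring

theorem radialSeries_conv (a b : ℕ → ℕ → ℝ) (x y : ℝ) :
    radialSeries (conv a b) x y = radialSeries a x y * radialSeries b x y := by
  ext n
  simp only [radialSeries, PowerSeries.coeff_mul, PowerSeries.coeff_mk, homogPart_conv]

/-- The array `k l ↦ array k l j`, with real values. -/
def realArray (j k l : ℕ) : ℝ := array k l j

theorem realArray_zero : realArray 0 = closedForm 0 := by
  funext k l
  rw [realArray, array_zero_right, closedForm_zero_left]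
  push_cast
  rfl

theorem realArray_succ (j : ℕ) : realArray (j + 1) = conv (realArray 0) (realArray j) := by
  funext k l
  simp only [realArray, array_succ_right k l j, conv]
  push_cast
  rfl

theorem radialSeries_realArray (j : ℕ) (x y : ℝ) :
    radialSeries (realArray j) x y = radialSeries (closedForm 0) x y ^ (j + 1) := by
  induction j with
  | zero => rw [realArray_zero, zero_add, pow_one]
  | succ j ih => rw [realArray_succ, radialSeries_conv, ih, realArray_zero, ← _root_.pow_succ']

/-- Setting `y = 1` loses nothing: within one degree the power of `x` determines the monomial. -/
theorem eq_of_homogPart_eq {a b : ℕ → ℕ → ℝ}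
    (h : ∀ x n, homogPart a x 1 n = homogPart b x 1 n) : a = b := by
  funext k l
  have hp : ∑ p ∈ antidiagonal (k + l), Polynomial.C (a p.1 p.2) * Polynomial.X ^ p.1 =
      ∑ p ∈ antidiagonal (k + l), Polynomial.C (b p.1 p.2) * Polynomial.X ^ p.1 := by
    refine Polynomial.funext fun x => ?_
    simpa [homogPart, Polynomial.eval_finsetSum] using h x (k + l)
  have hc (c : ℕ → ℕ → ℝ) : (∑ p ∈ antidiagonal (k + l),
      Polynomial.C (c p.1 p.2) * Polynomial.X ^ p.1).coeff k = c k l := by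
    simp only [Polynomial.finsetSum_coeff, Polynomial.coeff_C_mul_X_pow]
    rw [sum_eq_single (k, l)]
    · simp
    · rintro ⟨u, v⟩ huv hne
      rw [if_neg]
      rintro rfl
      rw [HasAntidiagonal.mem_antidiagonal] at huv
      exact hne (Prod.ext rfl (by simpa using huv))
    · simp
  rw [← hc a, hp, hc b]

theorem realArray_eq_closedForm (j : ℕ) : realArray j = closedForm j := by
  refine eq_of_homogPart_eq fun x n => ?_
  have h := (radialSeries_realArray j x 1).trans (radialSeries_closedForm_eq_pow j x 1).symm
  simpa only [radialSeries, PowerSeries.coeff_mk] using congrArg (PowerSeries.coeff n) h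

/-- The array in closed form. -/
theorem array_eq (k l j : ℕ) : (array k l j : ℝ) =
    ((j + k + l)! * (j + 2 * k + 2 * l)‼ * j‼ : ℝ) /
      (j ! * k ! * l ! * (j + 2 * k)‼ * (j + 2 * l)‼) :=
  congrFun (congrFun (realArray_eq_closedForm j) k) l

/-! ### Stirling asymptotics -/

theorem tendsto_log_factorial_sub_div :
    Tendsto (fun n : ℕ => (Real.log (n ! : ℝ) - (n * Real.log n - n)) / n) atTop (𝓝 0) := by
  have hs : Tendsto (fun n : ℕ => Real.log (Stirling.stirlingSeq n)) atTop
      (𝓝 (Real.log (√Real.pi))) :=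
    (Real.continuousAt_log (by positivity)).tendsto.comp Stirling.tendsto_stirlingSeq_sqrt_pi
  have hn : Tendsto (fun n : ℕ => (n : ℝ)) atTop atTop := tendsto_natCast_atTop_atTop
  have hl : Tendsto (fun n : ℕ => Real.log (n : ℝ) / n) atTop (𝓝 0) :=
    Real.isLittleO_log_id_atTop.tendsto_div_nhds_zero.comp hn
  have h := ((hs.div_atTop hn).add ((tendsto_const_nhds (x := Real.log 2 / 2)).div_atTop hn)).add
    (hl.const_mul (1 / 2))
  simp only [mul_zero, add_zero] at h
  refine h.congr' ?_
  filter_upwards [eventually_gt_atTop 0] with n hn0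
  have hn' : (n : ℝ) ≠ 0 := by exact_mod_cast hn0.ne'
  rw [Stirling.log_stirlingSeq_formula, Real.log_div hn' (Real.exp_ne_zero 1), Real.log_exp,
    Real.log_mul two_ne_zero hn']
  field_simp
  ring

/-- For `u N ∼ ν N`, the rescaled logarithm of `(u N)!`. -/
theorem tendsto_log_factorial {u : ℕ → ℕ} {ν : ℝ} (hν : 0 < ν)
    (hu : Tendsto (fun N : ℕ => (u N : ℝ) / N) atTop (𝓝 ν)) :
    Tendsto (fun N : ℕ => Real.log ((u N)! : ℝ) / N - u N / N * Real.log N) atTop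
      (𝓝 (ν * Real.log ν - ν)) := by
  have hN : Tendsto (fun n : ℕ => (n : ℝ)) atTop atTop := tendsto_natCast_atTop_atTop
  have hpos : ∀ᶠ N : ℕ in atTop, 0 < N := eventually_gt_atTop 0
  have huinf : Tendsto u atTop atTop := by
    rw [← tendsto_natCast_atTop_iff (R := ℝ)]
    refine (hu.pos_mul_atTop hν hN).congr' ?_
    filter_upwards [hpos] with N h
    have : (N : ℝ) ≠ 0 := by exact_mod_cast h.ne'
    field_simp
  have h1 := (tendsto_log_factorial_sub_div.comp huinf).mul hu
  have h2 := (hu.mul ((Real.continuousAt_log hν.ne').tendsto.comp hu)).sub hu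
  have h := h1.add h2
  rw [zero_mul, zero_add] at h
  refine h.congr' ?_
  filter_upwards [hpos, huinf.eventually_gt_atTop 0] with N h h'
  have a1 : (N : ℝ) ≠ 0 := by exact_mod_cast h.ne'
  have a2 : (u N : ℝ) ≠ 0 := by exact_mod_cast h'.ne'
  simp only [Function.comp]
  rw [Real.log_div a2 a1]
  field_simp
  ring

theorem doubleFactorial_le_succ (n : ℕ) : n ‼ ≤ (n + 1)‼ := by
  induction n using Nat.twoStepInduction with
  | zero => simp
  | one => simp [doubleFactorial]
  | more n ih _ =>
    rw [doubleFactorial_add_two, show n + 2 + 1 = (n + 1) + 2 by ring, doubleFactorial_add_two]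
    exact Nat.mul_le_mul (by omega) ih

/-- Since `n! = n‼ (n-1)‼` and `‼` is monotone, `n‼²` lies between `n!` and `(n+1)!`. This transfers
Stirling's formula to double factorials without a parity split. -/
theorem factorial_le_doubleFactorial_sq (n : ℕ) : n ! ≤ n ‼ ^ 2 := by
  cases n with
  | zero => simp
  | succ n =>
    rw [factorial_eq_mul_doubleFactorial, sq]
    exact Nat.mul_le_mul_left _ (doubleFactorial_le_succ n)

theorem doubleFactorial_sq_le_factorial (n : ℕ) : n ‼ ^ 2 ≤ (n + 1)! := by
  rw [factorial_eq_mul_doubleFactorial, sq]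
  exact Nat.mul_le_mul_right _ (doubleFactorial_le_succ n)

/-- For `u N ∼ ν N`, the rescaled logarithm of `(u N)‼`. -/
theorem tendsto_log_doubleFactorial {u : ℕ → ℕ} {ν : ℝ} (hν : 0 < ν)
    (hu : Tendsto (fun N : ℕ => (u N : ℝ) / N) atTop (𝓝 ν)) :
    Tendsto (fun N : ℕ => Real.log ((u N)‼ : ℝ) / N - u N / N * Real.log N / 2) atTop
      (𝓝 ((ν * Real.log ν - ν) / 2)) := by
  have hN : Tendsto (fun n : ℕ => (n : ℝ)) atTop atTop := tendsto_natCast_atTop_atTop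
  have hl : Tendsto (fun n : ℕ => Real.log (n : ℝ) / n) atTop (𝓝 0) :=
    Real.isLittleO_log_id_atTop.tendsto_div_nhds_zero.comp hN
  have hu1 : Tendsto (fun N : ℕ => ((u N + 1 : ℕ) : ℝ) / N) atTop (𝓝 ν) := by
    have := hu.add ((tendsto_const_nhds (x := (1 : ℝ))).div_atTop hN)
    rw [add_zero] at this
    refine this.congr fun N => ?_
    push_cast
    ring
  have lower := (tendsto_log_factorial hν hu).div_const 2
  -- Replacing `u N` by `u N + 1` changes the subtracted term by `log N / N`, which `hl`
  -- compensates.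
  have upper := ((tendsto_log_factorial hν hu1).add hl).div_const 2
  rw [add_zero] at upper
  have hd (n : ℕ) : (0 : ℝ) < (n ‼ : ℕ) := by exact_mod_cast doubleFactorial_pos n
  have hf (n : ℕ) : (0 : ℝ) < (n ! : ℕ) := by exact_mod_cast factorial_pos n
  refine tendsto_of_tendsto_of_tendsto_of_le_of_le lower upper ?_ ?_ <;> intro N
  · have h : Real.log ((u N)! : ℝ) ≤ 2 * Real.log ((u N)‼ : ℝ) := by
      rw [← Nat.cast_two, ← Real.log_pow]
      exact Real.log_le_log (hf _) (by exact_mod_cast factorial_le_doubleFactorial_sq _)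
    have := div_le_div_of_nonneg_right h (Nat.cast_nonneg (α := ℝ) N)
    simp only
    linarith [mul_div_assoc 2 (Real.log ((u N)‼ : ℝ)) (N : ℝ)]
  · have h : 2 * Real.log ((u N)‼ : ℝ) ≤ Real.log ((u N + 1)! : ℝ) := by
      rw [← Nat.cast_two, ← Real.log_pow]
      exact Real.log_le_log (by have := hd (u N); positivity)
        (by exact_mod_cast doubleFactorial_sq_le_factorial _)
    have := div_le_div_of_nonneg_right h (Nat.cast_nonneg (α := ℝ) N)
    simp only
    push_cast
    have e : ((u N : ℝ) + 1) / N * Real.log N = u N / N * Real.log N + Real.log N / N := by ring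
    linarith [mul_div_assoc 2 (Real.log ((u N)‼ : ℝ)) (N : ℝ)]

theorem log_array (k l j : ℕ) : Real.log (array k l j : ℝ) =
    Real.log ((j + k + l)! : ℝ) + Real.log ((j + 2 * k + 2 * l)‼ : ℝ) + Real.log (j ‼ : ℝ)
      - Real.log (j ! : ℝ) - Real.log (k ! : ℝ) - Real.log (l ! : ℝ)
      - Real.log ((j + 2 * k)‼ : ℝ) - Real.log ((j + 2 * l)‼ : ℝ) := by
  have hd (n : ℕ) : ((n ‼ : ℕ) : ℝ) ≠ 0 := by exact_mod_cast (doubleFactorial_pos n).ne'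
  have hf (n : ℕ) : ((n ! : ℕ) : ℝ) ≠ 0 := by exact_mod_cast factorial_ne_zero n
  have h1 := mul_ne_zero (hf j) (hf k)
  have h2 := mul_ne_zero h1 (hf l)
  have h3 := mul_ne_zero h2 (hd (j + 2 * k))
  rw [array_eq, Real.log_div (mul_ne_zero (mul_ne_zero (hf _) (hd _)) (hd _))
    (mul_ne_zero h3 (hd _)), Real.log_mul (mul_ne_zero (hf _) (hd _)) (hd _),
    Real.log_mul (hf _) (hd _), Real.log_mul h3 (hd _), Real.log_mul h2 (hd _),
    Real.log_mul h1 (hf _), Real.log_mul (hf _) (hf _)]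
  ring

theorem X_pos {kap lam gam : ℝ} (hkap : 0 < kap) (hlam : 0 < lam) (hgam : 0 < gam) :
    0 < X kap lam gam := by unfold X; positivity

theorem Y_pos {kap lam gam : ℝ} (hkap : 0 < kap) (hlam : 0 < lam) (hgam : 0 < gam) :
    0 < Y kap lam gam := by unfold Y; positivity

theorem Z_pos {kap lam gam : ℝ} (hkap : 0 < kap) (hlam : 0 < lam) (hgam : 0 < gam) :
    0 < Z kap lam gam := by unfold Z; positivity

theorem log_X {kap lam gam : ℝ} (hkap : 0 < kap) (hlam : 0 < lam) (hgam : 0 < gam) :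
    Real.log (X kap lam gam) = Real.log kap + Real.log (gam + 2 * kap)
      - Real.log (gam + kap + lam) - Real.log (gam + 2 * kap + 2 * lam) := by
  rw [X, show 2 * kap + gam = gam + 2 * kap by ring,
    show kap + lam + gam = gam + kap + lam by ring,
    show 2 * kap + 2 * lam + gam = gam + 2 * kap + 2 * lam by ring,
    Real.log_div (by positivity) (by positivity), Real.log_mul (by positivity) (by positivity),
    Real.log_mul (by positivity) (by positivity)]
  ring

theorem log_Y {kap lam gam : ℝ} (hkap : 0 < kap) (hlam : 0 < lam) (hgam : 0 < gam) :
    Real.log (Y kap lam gam) = Real.log lam + Real.log (gam + 2 * lam)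
      - Real.log (gam + kap + lam) - Real.log (gam + 2 * kap + 2 * lam) := by
  rw [Y, show 2 * lam + gam = gam + 2 * lam by ring,
    show kap + lam + gam = gam + kap + lam by ring,
    show 2 * kap + 2 * lam + gam = gam + 2 * kap + 2 * lam by ring,
    Real.log_div (by positivity) (by positivity), Real.log_mul (by positivity) (by positivity),
    Real.log_mul (by positivity) (by positivity)]
  ring

theorem log_Z {kap lam gam : ℝ} (hkap : 0 < kap) (hlam : 0 < lam) (hgam : 0 < gam) :
    Real.log (Z kap lam gam) = (Real.log gam + Real.log (gam + 2 * kap) + Real.log (gam + 2 * lam)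
      - Real.log (gam + 2 * kap + 2 * lam)) / 2 - Real.log (gam + kap + lam) := by
  rw [Z, show 2 * kap + gam = gam + 2 * kap by ring, show 2 * lam + gam = gam + 2 * lam by ring,
    show kap + lam + gam = gam + kap + lam by ring,
    show 2 * kap + 2 * lam + gam = gam + 2 * kap + 2 * lam by ring,
    Real.log_mul (by positivity) (by positivity), one_div, Real.log_inv,
    Real.log_sqrt (by positivity), Real.log_div (by positivity) (by positivity),
    Real.log_mul (by positivity) (by positivity), Real.log_mul (by positivity) (by positivity)]
  ring

/-- The exponential growth rate of the array in a positive direction. -/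
theorem tendsto_log_array {kap lam gam : ℝ} (hkap : 0 < kap) (hlam : 0 < lam) (hgam : 0 < gam)
    {k l j : ℕ → ℕ} (hk : Tendsto (fun N : ℕ => (k N : ℝ) / (N : ℝ)) atTop (𝓝 kap))
    (hl : Tendsto (fun N : ℕ => (l N : ℝ) / (N : ℝ)) atTop (𝓝 lam))
    (hj : Tendsto (fun N : ℕ => (j N : ℝ) / (N : ℝ)) atTop (𝓝 gam)) :
    Tendsto (fun N : ℕ => (N : ℝ)⁻¹ * Real.log (array (k N) (l N) (j N) : ℝ)) atTop
      (𝓝 (-kap * Real.log (X kap lam gam) - lam * Real.log (Y kap lam gam)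
        - gam * Real.log (Z kap lam gam))) := by
  have s1 : Tendsto (fun N : ℕ => ((j N + k N + l N : ℕ) : ℝ) / N) atTop
      (𝓝 (gam + kap + lam)) :=
    ((hj.add hk).add hl).congr fun N => by push_cast; ring
  have s2 : Tendsto (fun N : ℕ => ((j N + 2 * k N + 2 * l N : ℕ) : ℝ) / N) atTop
      (𝓝 (gam + 2 * kap + 2 * lam)) :=
    ((hj.add (hk.const_mul 2)).add (hl.const_mul 2)).congr fun N => by push_cast; ring
  have s3 : Tendsto (fun N : ℕ => ((j N + 2 * k N : ℕ) : ℝ) / N) atTop (𝓝 (gam + 2 * kap)) :=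
    (hj.add (hk.const_mul 2)).congr fun N => by push_cast; ring
  have s4 : Tendsto (fun N : ℕ => ((j N + 2 * l N : ℕ) : ℝ) / N) atTop (𝓝 (gam + 2 * lam)) :=
    (hj.add (hl.const_mul 2)).congr fun N => by push_cast; ring
  -- The subtracted multiples of `log N` cancel exactly: `(j+k+l) - j - k - l = 0` and `(j+2k+2l) +
  -- j - (j+2k) - (j+2l) = 0`. They carry `u N / N` and not its limit, because `(u N / N - ν) log N`
  -- need not tend to 0. The linear terms of Stirling's formula cancel by the same balance.
  have h := (((((((tendsto_log_factorial (by positivity) s1).add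
    (tendsto_log_doubleFactorial (by positivity) s2)).add
    (tendsto_log_doubleFactorial hgam hj)).sub (tendsto_log_factorial hgam hj)).sub
    (tendsto_log_factorial hkap hk)).sub (tendsto_log_factorial hlam hl)).sub
    (tendsto_log_doubleFactorial (by positivity) s3)).sub
    (tendsto_log_doubleFactorial (by positivity) s4)
  rw [log_X hkap hlam hgam, log_Y hkap hlam hgam, log_Z hkap hlam hgam]
  convert h using 1
  · funext N
    rw [log_array]
    push_cast
    ring
  · congr 1
    ring

/-! ### Summing the sections at `(X, Y)` -/

/-- The power series `P` converges absolutely at `1`, with sum `s`. -/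
def SumsTo (P : PowerSeries ℝ) (s : ℝ) : Prop :=
  (Summable fun n => ‖PowerSeries.coeff n P‖) ∧ ∑' n, PowerSeries.coeff n P = s

theorem SumsTo.mul {P R : PowerSeries ℝ} {s t : ℝ} (hP : SumsTo P s) (hR : SumsTo R t) :
    SumsTo (P * R) (s * t) := by
  have h1 := summable_norm_sum_mul_antidiagonal_of_summable_norm
    (f := fun n => PowerSeries.coeff n P) (g := fun n => PowerSeries.coeff n R) hP.1 hR.1
  have h2 := tsum_mul_tsum_eq_tsum_sum_antidiagonal_of_summable_norm
    (f := fun n => PowerSeries.coeff n P) (g := fun n => PowerSeries.coeff n R) hP.1 hR.1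
  rw [hP.2, hR.2] at h2
  simp only [SumsTo, PowerSeries.coeff_mul]
  exact ⟨h1, h2.symm⟩

theorem sumsTo_one : SumsTo 1 1 := by
  simp only [SumsTo, PowerSeries.coeff_one]
  refine ⟨(hasSum_ite_eq 0 (1 : ℝ)).summable.norm, tsum_ite_eq 0 _⟩

theorem SumsTo.pow {P : PowerSeries ℝ} {s : ℝ} (hP : SumsTo P s) (n : ℕ) :
    SumsTo (P ^ n) (s ^ n) := by
  induction n with
  | zero => simpa using sumsTo_one
  | succ n ih => rw [_root_.pow_succ, _root_.pow_succ]; exact ih.mul hP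

theorem sumsTo_quad (x y : ℝ) : SumsTo (quad x y) (1 - 2 * (x + y) + (x - y) ^ 2) := by
  have hc (n : ℕ) : PowerSeries.coeff n (quad x y) = (if n = 0 then 1 else 0)
      - 2 * (x + y) * (if n = 1 then 1 else 0) + (x - y) ^ 2 * (if n = 2 then 1 else 0) := by
    rw [quad, map_add, map_sub, PowerSeries.coeff_C_mul, PowerSeries.coeff_C_mul,
      PowerSeries.coeff_one, PowerSeries.coeff_X, PowerSeries.coeff_X_pow]
  have hz (n : ℕ) (hn : n ∉ range 3) : PowerSeries.coeff n (quad x y) = 0 := by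
    rw [Finset.mem_range, not_lt] at hn
    rw [hc, if_neg (by omega), if_neg (by omega), if_neg (by omega)]
    ring
  refine ⟨summable_of_ne_finset_zero (s := range 3) fun n hn => by rw [hz n hn, norm_zero], ?_⟩
  rw [tsum_eq_sum hz]
  simp only [sum_range_succ, hc]
  norm_num
  ring

theorem homogPart_closedForm_zero_nonneg {x y : ℝ} (hx : 0 ≤ x) (hy : 0 ≤ y) (n : ℕ) :
    0 ≤ homogPart (closedForm 0) x y n :=
  sum_nonneg fun p _ => by rw [closedForm_zero_left]; positivity

/-- The terms are the squares of `binom(n, k) u^k v^l`, and a sum of squares of nonnegative reals is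
at most the square of their sum, here `(u+v)^n`. -/
theorem homogPart_closedForm_zero_le {u v : ℝ} (hu : 0 ≤ u) (hv : 0 ≤ v) (n : ℕ) :
    homogPart (closedForm 0) (u ^ 2) (v ^ 2) n ≤ ((u + v) ^ 2) ^ n := by
  rw [← pow_mul, mul_comm, pow_mul, (Commute.all u v).add_pow']
  refine le_trans (le_of_eq ?_) (sum_sq_le_sq_sum_of_nonneg fun p _ => ?_)
  · refine sum_congr rfl fun p hp => ?_
    rw [closedForm_zero_left, HasAntidiagonal.mem_antidiagonal.1 hp, nsmul_eq_mul]
    ring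
  · positivity

theorem exists_sumsTo_radialSeries {x y : ℝ} (hx : 0 ≤ x) (hy : 0 ≤ y) (h : √x + √y < 1) :
    ∃ f : ℝ, 0 ≤ f ∧ SumsTo (radialSeries (closedForm 0) x y) f := by
  refine ⟨_, tsum_nonneg fun n => ?_, ?_, rfl⟩
  · rw [radialSeries, PowerSeries.coeff_mk]
    exact homogPart_closedForm_zero_nonneg hx hy n
  · have h0 : 0 ≤ √x + √y := by positivity
    refine Summable.of_nonneg_of_le (fun n => norm_nonneg _) (fun n => ?_)
      (summable_geometric_of_lt_one (sq_nonneg (√x + √y)) (by nlinarith))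
    rw [radialSeries, PowerSeries.coeff_mk,
      Real.norm_of_nonneg (homogPart_closedForm_zero_nonneg hx hy n)]
    simpa only [Real.sq_sqrt hx, Real.sq_sqrt hy] using
      homogPart_closedForm_zero_le (Real.sqrt_nonneg x) (Real.sqrt_nonneg y) n

theorem SumsTo.sq_mul_eq_one {x y f : ℝ} (h : SumsTo (radialSeries (closedForm 0) x y) f) :
    f ^ 2 * (1 - 2 * (x + y) + (x - y) ^ 2) = 1 := by
  have h1 := (h.pow 2).mul (sumsTo_quad x y)
  have h2 := radialSeries_closedForm_sq_mul 0 x y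
  rw [zero_add, pow_one] at h2
  rw [h2] at h1
  exact h1.2.symm.trans sumsTo_one.2

theorem hasSum_of_hasSum_antidiagonal {g : ℕ × ℕ → ℝ} (hg : ∀ p, 0 ≤ g p) {s : ℝ}
    (h : HasSum (fun n => ∑ p ∈ HasAntidiagonal.antidiagonal n, g p) s) : HasSum g s := by
  have hfib (n : ℕ) : HasSum (fun p : HasAntidiagonal.antidiagonal n => g p)
      (∑ p ∈ HasAntidiagonal.antidiagonal n, g p) := by
    rw [← Finset.sum_coe_sort]
    exact hasSum_fintype _
  rw [← HasAntidiagonal.sigmaAntidiagonalEquivProd.hasSum_iff]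
  have hs : Summable (g ∘ HasAntidiagonal.sigmaAntidiagonalEquivProd) := by
    refine (summable_sigma_of_nonneg fun _ => hg _).2 ⟨fun n => (hfib n).summable, ?_⟩
    refine h.summable.congr fun n => ?_
    exact (hfib n).tsum_eq.symm
  have := hs.hasSum.sigma (fun n => hfib n)
  rw [h.unique this]
  exact hs.hasSum

theorem Z_sq {kap lam gam : ℝ} (hkap : 0 < kap) (hlam : 0 < lam) (hgam : 0 < gam) :
    Z kap lam gam ^ 2 = 1 - 2 * (X kap lam gam + Y kap lam gam) +
      (X kap lam gam - Y kap lam gam) ^ 2 := by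
  rw [Z, mul_pow, Real.sq_sqrt (by positivity), X, Y]
  field_simp
  ring

/-- Positivity of `Z²` reads `4XY < (1 - X - Y)²`. With `X + Y < 1` the root gives `2√(XY) < 1 - X -
Y`, which is the claim; that bound excludes the other region of positivity, `|√X - √Y| > 1`. -/
theorem sqrt_X_add_sqrt_Y_lt_one {kap lam gam : ℝ} (hkap : 0 < kap) (hlam : 0 < lam)
    (hgam : 0 < gam) : √(X kap lam gam) + √(Y kap lam gam) < 1 := by
  have hX := X_pos hkap hlam hgam
  have hY := Y_pos hkap hlam hgam
  have hZ := Z_pos hkap hlam hgam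
  have hq := Z_sq hkap hlam hgam
  have hlt : X kap lam gam + Y kap lam gam < 1 := by
    rw [X, Y, ← add_div, div_lt_one (by positivity)]
    nlinarith [mul_pos hkap hlam, mul_pos hkap hgam, mul_pos hlam hgam, mul_pos hgam hgam]
  have hu := Real.sqrt_nonneg (X kap lam gam)
  have hv := Real.sqrt_nonneg (Y kap lam gam)
  have hu2 := Real.sq_sqrt hX.le
  have hv2 := Real.sq_sqrt hY.le
  set u := √(X kap lam gam)
  set v := √(Y kap lam gam)
  rw [← hu2, ← hv2] at hq hlt
  have h1 : (2 * (u * v)) ^ 2 < (1 - (u ^ 2 + v ^ 2)) ^ 2 := by nlinarith [pow_pos hZ 2]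
  have h2 := lt_of_pow_lt_pow_left₀ 2 (by linarith) h1
  nlinarith

/-- The two-variable section of the generating function at the distinguished point. -/
theorem hasSum_array_mul {kap lam gam : ℝ} (hkap : 0 < kap) (hlam : 0 < lam) (hgam : 0 < gam)
    (j : ℕ) : HasSum (fun p : ℕ × ℕ =>
      (array p.1 p.2 j : ℝ) * X kap lam gam ^ p.1 * Y kap lam gam ^ p.2)
      ((Z kap lam gam)⁻¹ ^ (j + 1)) := by
  have hX := X_pos hkap hlam hgam
  have hY := Y_pos hkap hlam hgam
  have hZ := Z_pos hkap hlam hgam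
  obtain ⟨f, hf0, hf⟩ := exists_sumsTo_radialSeries hX.le hY.le
    (sqrt_X_add_sqrt_Y_lt_one hkap hlam hgam)
  -- Evaluating `P² Q = 1` at `t = 1` gives `(f Z)² = 1`; nonnegativity selects the root.
  have hfZ : f = (Z kap lam gam)⁻¹ := by
    have h := hf.sq_mul_eq_one
    rw [← Z_sq hkap hlam hgam, ← mul_pow] at h
    exact eq_inv_of_mul_eq_one_left
      ((pow_eq_one_iff_of_nonneg (mul_nonneg hf0 hZ.le) two_ne_zero).1 h)
  have h := hf.pow (j + 1)
  rw [← radialSeries_realArray, hfZ] at h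
  refine hasSum_of_hasSum_antidiagonal (fun p => by positivity) ?_
  have hs := h.1.of_norm.hasSum
  rw [h.2] at hs
  simpa only [radialSeries, PowerSeries.coeff_mk, homogPart, realArray] using hs

/-! ### Convergence on the polydisc and singularity -/

theorem array_mul_le {kap lam gam : ℝ} (hkap : 0 < kap) (hlam : 0 < lam) (hgam : 0 < gam)
    (k l j : ℕ) : (array k l j : ℝ) * X kap lam gam ^ k * Y kap lam gam ^ l ≤
      (Z kap lam gam)⁻¹ ^ (j + 1) := by
  have hX := X_pos hkap hlam hgam
  have hY := Y_pos hkap hlam hgam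
  exact le_hasSum (hasSum_array_mul hkap hlam hgam j) (k, l) fun p _ => by positivity

theorem norm_genTerm (q : ℂ × ℂ × ℂ) (n : ℕ × ℕ × ℕ) : ‖genTerm q n‖ =
    array n.1 n.2.1 n.2.2 * ‖q.1‖ ^ n.1 * ‖q.2.1‖ ^ n.2.1 * ‖q.2.2‖ ^ n.2.2 := by
  simp [genTerm]

theorem summable_norm_genTerm {kap lam gam : ℝ} (hkap : 0 < kap) (hlam : 0 < lam) (hgam : 0 < gam)
    {q : ℂ × ℂ × ℂ} (h1 : ‖q.1‖ < X kap lam gam) (h2 : ‖q.2.1‖ < Y kap lam gam)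
    (h3 : ‖q.2.2‖ < Z kap lam gam) : Summable fun n : ℕ × ℕ × ℕ => ‖genTerm q n‖ := by
  have hX := X_pos hkap hlam hgam
  have hY := Y_pos hkap hlam hgam
  have hZ := Z_pos hkap hlam hgam
  have geo {a b : ℝ} (ha : 0 ≤ a) (hb : 0 < b) (hab : a < b) : Summable fun n : ℕ => (a / b) ^ n :=
    summable_geometric_of_lt_one (by positivity) ((div_lt_one hb).2 hab)
  have s23 := (geo (norm_nonneg _) hY h2).mul_of_nonneg (geo (norm_nonneg _) hZ h3)
    (fun n => by positivity) (fun n => by positivity)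
  have s123 := (geo (norm_nonneg _) hX h1).mul_of_nonneg s23
    (fun n => by positivity) (fun n => by positivity)
  refine Summable.of_nonneg_of_le (fun _ => norm_nonneg _) (fun n => ?_)
    (s123.mul_left (Z kap lam gam)⁻¹)
  obtain ⟨k, l, j⟩ := n
  rw [norm_genTerm]
  have hb := array_mul_le hkap hlam hgam k l j
  have hc : 0 ≤ (‖q.1‖ / X kap lam gam) ^ k * ((‖q.2.1‖ / Y kap lam gam) ^ l * ‖q.2.2‖ ^ j) := by
    positivity
  calc (array k l j : ℝ) * ‖q.1‖ ^ k * ‖q.2.1‖ ^ l * ‖q.2.2‖ ^ j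
      = ((array k l j : ℝ) * X kap lam gam ^ k * Y kap lam gam ^ l) *
        ((‖q.1‖ / X kap lam gam) ^ k * ((‖q.2.1‖ / Y kap lam gam) ^ l * ‖q.2.2‖ ^ j)) := by
        rw [div_pow, div_pow]
        field_simp
    _ ≤ (Z kap lam gam)⁻¹ ^ (j + 1) *
        ((‖q.1‖ / X kap lam gam) ^ k * ((‖q.2.1‖ / Y kap lam gam) ^ l * ‖q.2.2‖ ^ j)) :=
        mul_le_mul_of_nonneg_right hb hc
    _ = _ := by
        rw [div_pow ‖q.2.2‖, inv_pow, _root_.pow_succ]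
        field_simp

/-- The generating function diverges at the distinguished point. -/
theorem not_summable_array_mul {kap lam gam : ℝ} (hkap : 0 < kap) (hlam : 0 < lam)
    (hgam : 0 < gam) : ¬ Summable fun n : ℕ × ℕ × ℕ => (array n.1 n.2.1 n.2.2 : ℝ) *
      X kap lam gam ^ n.1 * Y kap lam gam ^ n.2.1 * Z kap lam gam ^ n.2.2 := by
  intro h
  have hZ := Z_pos hkap hlam hgam
  let e : ℕ × (ℕ × ℕ) ≃ ℕ × ℕ × ℕ :=
    (Equiv.prodComm ℕ (ℕ × ℕ)).trans (Equiv.prodAssoc ℕ ℕ ℕ)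
  have h' := (e.summable_iff.2 h).prod
  -- Summing over `(k, l)` first gives `Z^{-(j+1)} Z^j = Z⁻¹` for every `j`.
  have hconst : (fun j : ℕ => ∑' p : ℕ × ℕ, (array p.1 p.2 j : ℝ) *
      X kap lam gam ^ p.1 * Y kap lam gam ^ p.2 * Z kap lam gam ^ j) =
      fun _ => (Z kap lam gam)⁻¹ := by
    funext j
    rw [((hasSum_array_mul hkap hlam hgam j).mul_right (Z kap lam gam ^ j)).tsum_eq, inv_pow, _root_.pow_succ]
    field_simp
  have h'' : Summable fun _ : ℕ => (Z kap lam gam)⁻¹ := hconst ▸ h'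
  exact (inv_pos.2 hZ).ne' ((summable_const_iff _).1 h'')

/-- A series of nonnegative terms `r n` converges if the sums `∑ r n t ^ d n` stay bounded
as `t ↑ 1`. -/
theorem summable_of_eventually_tsum_le {ι : Type*} {r : ι → ℝ} (hr : ∀ n, 0 ≤ r n) (d : ι → ℕ)
    {M : ℝ} (hs : ∀ t ∈ Set.Ioo (0 : ℝ) 1, Summable fun n => r n * t ^ d n)
    (hM : ∀ᶠ t in 𝓝[<] (1 : ℝ), ∑' n, r n * t ^ d n ≤ M) : Summable r := by
  -- Finite partial sums are continuous up to `t = 1`, so they inherit the bound `M`.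
  refine summable_of_sum_le (c := M) hr fun s => ?_
  have hc : Tendsto (fun t : ℝ => ∑ n ∈ s, r n * t ^ d n) (𝓝[<] 1) (𝓝 (∑ n ∈ s, r n)) := by
    have : Continuous fun t : ℝ => ∑ n ∈ s, r n * t ^ d n := by fun_prop
    simpa using (this.tendsto 1).mono_left nhdsWithin_le_nhds
  refine le_of_tendsto hc ?_
  filter_upwards [hM, Ioo_mem_nhdsLT zero_lt_one] with t ht h01
  exact ((hs t h01).sum_le_tsum s fun n _ =>
    mul_nonneg (hr n) (pow_nonneg h01.1.le _)).trans ht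

/-- Pringsheim's argument: along `t ↦ t·p` the terms are nonnegative, and an extension continuous at
`p` would keep the sums bounded as `t ↑ 1`. The series would then converge at `p`, contradicting
`not_summable_array_mul`. -/
theorem isSingularPoint {kap lam gam : ℝ} (hkap : 0 < kap) (hlam : 0 < lam) (hgam : 0 < gam) :
    IsSingularPoint ((X kap lam gam : ℂ), (Y kap lam gam : ℂ), (Z kap lam gam : ℂ)) := by
  have hX := X_pos hkap hlam hgam
  have hY := Y_pos hkap hlam hgam
  have hZ := Z_pos hkap hlam hgam
  have hsum : ∀ q ∈ polydisc ((X kap lam gam : ℂ), (Y kap lam gam : ℂ), (Z kap lam gam : ℂ)),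
      Summable fun n : ℕ × ℕ × ℕ => ‖genTerm q n‖ := by
    rintro q ⟨h1, h2, h3⟩
    simp only [Complex.norm_real, Real.norm_of_nonneg hX.le, Real.norm_of_nonneg hY.le,
      Real.norm_of_nonneg hZ.le] at h1 h2 h3
    exact summable_norm_genTerm hkap hlam hgam h1 h2 h3
  refine ⟨hsum, ?_⟩
  rintro ⟨G, hG, hGF⟩
  set p : ℂ × ℂ × ℂ := ((X kap lam gam : ℂ), (Y kap lam gam : ℂ), (Z kap lam gam : ℂ)) with hp
  let q : ℝ → ℂ × ℂ × ℂ := fun t => ((t : ℂ) * X kap lam gam, (t : ℂ) * Y kap lam gam,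
    (t : ℂ) * Z kap lam gam)
  have hmem : ∀ t ∈ Set.Ioo (0 : ℝ) 1, q t ∈ polydisc p := by
    rintro t ⟨h0, h1⟩
    simp only [polydisc, Set.mem_ofPred_eq, hp, q, norm_mul, Complex.norm_real,
      Real.norm_of_nonneg hX.le, Real.norm_of_nonneg hY.le, Real.norm_of_nonneg hZ.le,
      Real.norm_of_nonneg h0.le]
    exact ⟨by nlinarith, by nlinarith, by nlinarith⟩
  have hq : Tendsto q (𝓝[<] 1) (𝓝[polydisc p] p) := by
    refine tendsto_nhdsWithin_iff.2 ⟨?_, ?_⟩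
    · have hc : Continuous q := by fun_prop
      have := (hc.tendsto 1).mono_left (nhdsWithin_le_nhds (s := Set.Iio 1))
      simpa [q] using this
    · filter_upwards [Ioo_mem_nhdsLT zero_lt_one] with t ht using hmem t ht
  let r : ℕ × ℕ × ℕ → ℝ := fun n => (array n.1 n.2.1 n.2.2 : ℝ) *
      X kap lam gam ^ n.1 * Y kap lam gam ^ n.2.1 * Z kap lam gam ^ n.2.2
  let d : ℕ × ℕ × ℕ → ℕ := fun n => n.1 + n.2.1 + n.2.2
  have hterm (t : ℝ) (n : ℕ × ℕ × ℕ) : genTerm (q t) n = ((r n * t ^ d n : ℝ) : ℂ) := by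
    simp only [genTerm, q, r, d]
    push_cast
    ring
  have hgen (t : ℝ) : genFun (q t) = ((∑' n, r n * t ^ d n : ℝ) : ℂ) := by
    rw [genFun, Complex.ofReal_tsum]
    exact tsum_congr (hterm t)
  have hs : ∀ t ∈ Set.Ioo (0 : ℝ) 1, Summable fun n => r n * t ^ d n := by
    intro t ht
    have := hsum (q t) (hmem t ht)
    simp only [hterm, Complex.norm_real] at this
    exact this.of_norm
  refine not_summable_array_mul hkap hlam hgam
    (summable_of_eventually_tsum_le (r := r) (M := ‖G p‖ + 1) (fun n => by positivity) d hs ?_)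
  have hGq : Tendsto (fun t => ‖G (q t)‖) (𝓝[<] 1) (𝓝 ‖G p‖) :=
    (hG.continuousAt.tendsto.comp (hq.mono_right nhdsWithin_le_nhds)).norm
  filter_upwards [hGq.eventually_le_const (lt_add_one _), hq.eventually hGF] with t h1 h2
  rw [h2, hgen, Complex.norm_real] at h1
  exact (Real.le_norm_self _).trans h1

end Pinsky

theorem theorem2p4 (kap lam gam : ℝ) (hkap : 0 < kap) (hlam : 0 < lam) (hgam : 0 < gam) :
    (∀ k l j : ℕ → ℕ,
      Tendsto (fun N : ℕ => (k N : ℝ) / (N : ℝ)) atTop (𝓝 kap) →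
      Tendsto (fun N : ℕ => (l N : ℝ) / (N : ℝ)) atTop (𝓝 lam) →
      Tendsto (fun N : ℕ => (j N : ℝ) / (N : ℝ)) atTop (𝓝 gam) →
      Tendsto (fun N : ℕ => (N : ℝ)⁻¹ * Real.log (Pinsky.array (k N) (l N) (j N) : ℝ)) atTop
        (𝓝 (-kap * Real.log (Pinsky.X kap lam gam) - lam * Real.log (Pinsky.Y kap lam gam)
          - gam * Real.log (Pinsky.Z kap lam gam)))) ∧
    ((Pinsky.X kap lam gam : ℂ), (Pinsky.Y kap lam gam : ℂ), (Pinsky.Z kap lam gam : ℂ))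
      ∈ Pinsky.singularVariety ∧
    Pinsky.IsSingularPoint
      ((Pinsky.X kap lam gam : ℂ), (Pinsky.Y kap lam gam : ℂ), (Pinsky.Z kap lam gam : ℂ)) := by
  refine ⟨fun k l j hk hl hj => Pinsky.tendsto_log_array hkap hlam hgam hk hl hj, ?_,
    Pinsky.isSingularPoint hkap hlam hgam⟩
  have h := Pinsky.Z_sq hkap hlam hgam
  simp only [Pinsky.singularVariety, Set.mem_ofPred_eq]
  exact_mod_cast h
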